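/- Let $k$ be an even positive integer, let $N\ge 1$, and let $p/q$ (with $p,q\in\mathbb Z$, $q>0$) be a rational number that is $\Gamma_0(N)$-equivalent to $i\infty$, i.e. $p/q=\gamma(\infty)$ for some $\gamma\in\Gamma_0(N)$, and such that $p^2\equiv 1 \pmod q$. Let $f\in S_k(\Gamma_0(N))$ be a cusp form with Fourier expansion $$f(z)=\sum_{n\ge 1} a_n\, n^{\frac{k-1}{2}} e(nz),\qquad e(z)=e^{2\pi i z},$$ where $a_n\in\mathbb R$ for all $n\ge 1$ and $a_1\ne 0$. Then the Dirichlet series $$L_{p/q}(s,f)=\sum_{n\ge 1} a_n\, e\!\left(\frac{np}{q}\right) n^{-s},$$ which converges absolutely in some right half-plane, continues to an entire function of $s$, and this function has infinitely many zeros on the critical line $\operatorname{Re} s=\tfrac12$. -/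

import Mathlib

open scoped MatrixGroups

/-- The point `x` of `ℝ` is `Γ₀(N)`-equivalent to `i∞`: some `γ ∈ Γ₀(N)`, acting on the boundary
`ℝ ∪ {∞}` of the upper half plane by Möbius transformations, maps `∞` to `x`. -/
def IsGamma0EquivInfty (N : ℕ) (x : ℝ) : Prop :=
  ∃ γ ∈ CongruenceSubgroup.Gamma0 N,
    Matrix.SpecialLinearGroup.mapGL ℝ γ • (OnePoint.infty : OnePoint ℝ) = (x : OnePoint ℝ)

/-- The space `S_k(Γ₀(N))` of cusp forms of weight `k` for `Γ₀(N)`. -/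
abbrev CuspFormGamma0 (N : ℕ) (k : ℤ) : Type :=
  CuspForm ((CongruenceSubgroup.Gamma0 N).map (Matrix.SpecialLinearGroup.mapGL ℝ)) k

/-- `a` is the sequence of normalized Fourier coefficients of `f`, a function on the upper half
plane, in weight `k`: `f(z) = ∑_{n ≥ 1} a_n n^{(k-1)/2} e(nz)` for all `z`. -/
def HasNormalizedFourierExpansion (k : ℕ) (f : UpperHalfPlane → ℂ) (a : ℕ → ℂ) : Prop :=
  ∀ z : UpperHalfPlane,
    HasSum (fun n : ℕ+ => a n * (((n : ℝ) ^ (((k : ℝ) - 1) / 2) : ℝ) : ℂ) *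
      Complex.exp (2 * Real.pi * Complex.I * n * z)) (f z)

/-- The additively twisted coefficients `a_n e(n x)`. -/
noncomputable def additiveTwist (a : ℕ → ℂ) (x : ℝ) (n : ℕ) : ℂ :=
  a n * Complex.exp (2 * Real.pi * Complex.I * n * x)

/-- `L` is the entire continuation of the Dirichlet series `∑_{n ≥ 1} c_n n^{-s}`: the series
converges absolutely in some right half-plane, `L` is entire, and `L(s)` is the sum of the series
wherever `s` lies to the right of the abscissa of absolute convergence. (By the identity theorem
there is at most one such `L`.) -/
structure IsEntireContinuation (c : ℕ → ℂ) (L : ℂ → ℂ) : Prop where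
  abscissa_lt_top : LSeries.abscissaOfAbsConv c < ⊤
  differentiable : Differentiable ℂ L
  eq_LSeries : ∀ s : ℂ, LSeries.abscissaOfAbsConv c < s.re → L s = LSeries c s

open Complex MeasureTheory Filter Topology FourierTransform Set
open UpperHalfPlane (ofComplex atImInfty)
open scoped ModularForm ComplexConjugate UpperHalfPlane

/-! The argument is Hardy's. Write `k = 2m` and restrict `f` to the vertical line through `p/q`, in
the logarithmic coordinate `G(ζ) = exp(-mζ) f(p/q + i exp(-ζ)/q)`. This is holomorphic on the strip
`|im ζ| < π/2`, and its Fourier transform `H` on the real line is the Mellin transform of `f` on the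
critical line: the twisted L-function times nonvanishing factors. Since `p² ≡ 1 mod q` and the
coefficients are real, `f` satisfies a functional equation on this line
(`CuspFormGamma0.functional_equation`), which makes `H` everywhere real or everywhere purely
imaginary. It also makes the Mellin transform entire, which gives the continuation.

Suppose `H` has no zero beyond some `T`. By continuity its phase is constant there. Fourier
inversion gives `G(-iφ) = ∫ exp(2πφv) H(v) dv`. As `φ → π/2` the left side stays bounded, because
the point of the upper half plane runs along a circle that meets the real line at the cusp `(p-1)/q`
nontangentially. Constant phase rules out cancellation, so `∫ exp(2πφv) |H(v)| dv` is bounded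
uniformly in `φ`, and `G` is bounded on the whole half-strip `-π/2 < im ζ ≤ 0`
(`bounded_of_fourier_phase`). Hence `f` is bounded on a half-plane `re τ ≤ x`. Modularity forbids
this for nonzero `f` (`CuspFormGamma0.eq_zero_of_bounded`), and `a₁ ≠ 0` makes `f` nonzero. -/

/-! ### Fourier transforms of holomorphic functions on a strip -/

lemma integrable_exp_neg_mul_abs {b : ℝ} (hb : 0 < b) :
    Integrable (fun u : ℝ => Real.exp (-b * |u|)) := by
  have h1 : IntegrableOn (fun u : ℝ => Real.exp (-b * |u|)) (Ioi 0) :=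
    (integrableOn_exp_mul_Ioi (neg_lt_zero.mpr hb) 0).congr_fun
      (fun u (hu : 0 < u) => by simp [abs_of_pos hu]) measurableSet_Ioi
  have h2 : IntegrableOn (fun u : ℝ => Real.exp (-b * |u|)) (Iic 0) :=
    (integrableOn_exp_mul_Iic hb 0).congr_fun
      (fun u (hu : u ≤ 0) => by simp [abs_of_nonpos hu]) measurableSet_Iic
  rw [← integrableOn_univ, ← Iic_union_Ioi (a := (0 : ℝ))]
  exact h2.union h1

/-- The integral along a horizontal line of a holomorphic function which decays exponentially in
a horizontal strip does not depend on the line. -/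
lemma integral_horizontal_shift {h : ℂ → ℂ} {φ C : ℝ}
    (hd : ∀ z : ℂ, |z.im| ≤ |φ| → DifferentiableAt ℂ h z)
    (hC : ∀ z : ℂ, |z.im| ≤ |φ| → ‖h z‖ ≤ C * Real.exp (-|z.re|)) :
    ∫ u : ℝ, h u = ∫ u : ℝ, h (u - φ * I) := by
  have hint : ∀ ψ : ℝ, |ψ| ≤ |φ| → Integrable (fun u : ℝ => h (u + ψ * I)) := by
    intro ψ hψ
    refine ((integrable_exp_neg_mul_abs one_pos).const_mul C).mono' ?_ ?_
    · refine Continuous.aestronglyMeasurable ?_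
      refine continuous_iff_continuousAt.mpr fun u => ?_
      have := (hd (u + ψ * I) (by simpa using hψ)).continuousAt
      exact this.comp (f := fun u : ℝ => (u + ψ * I : ℂ)) (by fun_prop)
    · filter_upwards with u
      simpa using hC (u + ψ * I) (by simpa using hψ)
  have hlim : ∀ ψ : ℝ, |ψ| ≤ |φ| →
      Tendsto (fun R : ℝ => ∫ u in (-R)..R, h (u + ψ * I)) atTop
        (𝓝 (∫ u : ℝ, h (u + ψ * I))) := fun ψ hψ =>
    intervalIntegral_tendsto_integral (hint ψ hψ) tendsto_neg_atTop_atBot tendsto_id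
  have hvert : ∀ σ : ℝ, |σ| = 1 →
      Tendsto (fun R : ℝ => ∫ y in (0 : ℝ)..(-φ), h ((σ * R : ℝ) + y * I)) atTop (𝓝 0) := by
    intro σ hσ
    refine squeeze_zero_norm' (a := fun R : ℝ => C * Real.exp (-R) * |φ|) ?_ ?_
    · filter_upwards [eventually_ge_atTop 0] with R hR
      have := intervalIntegral.norm_integral_le_of_norm_le_const (a := 0) (b := -φ)
        (f := fun y : ℝ => h ((σ * R : ℝ) + y * I)) (C := C * Real.exp (-R)) (fun y hy => by
          have hy' : |y| ≤ |φ| := by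
            rcases abs_cases φ with h | h <;> rcases abs_cases y with h' | h' <;>
            rcases mem_uIoc.mp hy with h'' | h'' <;> linarith [h''.1, h''.2]
          have := hC ((σ * R : ℝ) + y * I) (by simpa using hy')
          simpa [abs_mul, hσ, abs_of_nonneg hR] using this)
      simpa using this
    · have : Tendsto (fun R : ℝ => C * Real.exp (-R) * |φ|) atTop (𝓝 (C * 0 * |φ|)) :=
        ((Real.tendsto_exp_neg_atTop_nhds_zero).const_mul C).mul_const _
      simpa using this
  -- Cauchy's theorem on a rectangle; its vertical sides vanish in the limit by `hvert`.
  have hrect : ∀ R : ℝ, (∫ u in (-R)..R, h (u + (0 : ℝ) * I)) - (∫ u in (-R)..R, h (u + (-φ : ℝ) * I))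
      + I • (∫ y in (0 : ℝ)..(-φ), h ((1 * R : ℝ) + y * I))
      - I • (∫ y in (0 : ℝ)..(-φ), h ((-1 * R : ℝ) + y * I)) = 0 := by
    intro R
    have := integral_boundary_rect_eq_zero_of_differentiableOn h (-R : ℂ) (R - φ * I) (by
      intro z hz
      refine (hd z ?_).differentiableWithinAt
      have hz' := hz.2
      simp only [mem_preimage, neg_im, ofReal_im, neg_zero, sub_im, mul_im, ofReal_re, I_im,
        mul_one, I_re, mul_zero, add_zero, zero_sub] at hz'
      rcases mem_uIcc.mp hz' with h' | h' <;> rcases abs_cases φ with h | h <;>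
        rcases abs_cases z.im with h'' | h'' <;> linarith [h'.1, h'.2])
    simpa using this
  have h0 := ((((hlim 0 (by simp)).sub (hlim (-φ) (by simp))).add
    ((hvert 1 (by simp)).const_smul I)).sub ((hvert (-1) (by simp)).const_smul I))
  have h1 := tendsto_nhds_unique (h0.congr (fun R => hrect R)) tendsto_const_nhds
  simp only [smul_zero, add_zero, sub_zero, sub_eq_zero] at h1
  simpa [sub_eq_add_neg] using h1

section Strip

variable {a : ℝ} {G : ℂ → ℂ}

lemma continuous_horizontal (hd : DifferentiableOn ℂ G {z | |z.im| < a}) {φ : ℝ} (hφ : |φ| < a) :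
    Continuous fun u : ℝ => G (u - φ * I) := by
  have ho : IsOpen {z : ℂ | |z.im| < a} := isOpen_lt (by fun_prop) continuous_const
  refine hd.continuousOn.comp_continuous (by fun_prop) fun u => by simpa using hφ

lemma integrable_horizontal (hd : DifferentiableOn ℂ G {z | |z.im| < a})
    (hdec : ∀ b < a, ∃ C, ∀ z : ℂ, |z.im| ≤ b → ‖G z‖ ≤ C * Real.exp (-|z.re|))
    {φ : ℝ} (hφ : |φ| < a) : Integrable fun u : ℝ => G (u - φ * I) := by
  obtain ⟨C, hC⟩ := hdec |φ| hφ
  refine ((integrable_exp_neg_mul_abs one_pos).const_mul C).mono'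
    (continuous_horizontal hd hφ).aestronglyMeasurable ?_
  filter_upwards with u
  simpa using hC (u - φ * I) (by simp)

/-- Contour shift applied to `exp(-2πivz) G(z)`: on the lower line the kernel alone produces the
real exponential. -/
lemma fourier_horizontal_shift (hd : DifferentiableOn ℂ G {z | |z.im| < a})
    (hdec : ∀ b < a, ∃ C, ∀ z : ℂ, |z.im| ≤ b → ‖G z‖ ≤ C * Real.exp (-|z.re|))
    {φ : ℝ} (hφ : |φ| < a) (v : ℝ) :
    𝓕 (fun u : ℝ => G (u - φ * I)) v =
      Real.exp (2 * Real.pi * φ * v) * 𝓕 (fun u : ℝ => G u) v := by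
  have ho : IsOpen {z : ℂ | |z.im| < a} := isOpen_lt (by fun_prop) continuous_const
  obtain ⟨C, hC⟩ := hdec |φ| hφ
  have hC0 : 0 ≤ C := by
    have := (norm_nonneg _).trans (hC 0 (by simp)); simpa using this
  have key := integral_horizontal_shift (h := fun z => cexp (-(2 * Real.pi * v) * I * z) * G z)
    (φ := φ) (C := Real.exp (2 * Real.pi * |v| * |φ|) * C)
    (fun z hz => by
      have : DifferentiableAt ℂ G z := hd.differentiableAt (ho.mem_nhds (lt_of_le_of_lt hz hφ))
      fun_prop)
    (fun z hz => by
      rw [norm_mul, norm_exp, mul_assoc (Real.exp _)]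
      refine mul_le_mul (Real.exp_le_exp.mpr ?_) (hC z hz) (norm_nonneg _) (Real.exp_pos _).le
      · simp
        have : v * z.im ≤ |v| * |φ| := by
          refine (le_abs_self _).trans ?_
          rw [abs_mul]; gcongr
        nlinarith [Real.pi_pos])
  simp only [Real.fourier_real_eq_integral_exp_smul, smul_eq_mul]
  have e1 : ∀ u : ℝ, cexp (-(2 * Real.pi * v) * I * u) * G u =
      cexp (↑(-2 * Real.pi * u * v) * I) * G u := by
    intro u; congr 2; push_cast; ring
  have e2 : ∀ u : ℝ, cexp (-(2 * Real.pi * v) * I * (u - φ * I)) * G (u - φ * I) =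
      Real.exp (-(2 * Real.pi * φ * v)) * (cexp (↑(-2 * Real.pi * u * v) * I) * G (u - φ * I)) := by
    intro u
    rw [← mul_assoc, ofReal_exp, ← Complex.exp_add]
    congr 2; push_cast; ring_nf; simp; ring
  simp only [e1, e2] at key
  rw [integral_const_mul] at key
  rw [key, ← mul_assoc, ← ofReal_mul, ← Real.exp_add]
  simp

/-- Shifting the contour by `b` or by `-b`, according to the sign of `v`, gains the exponential
factor. -/
lemma norm_fourier_le_exp (hd : DifferentiableOn ℂ G {z | |z.im| < a})
    (hdec : ∀ b < a, ∃ C, ∀ z : ℂ, |z.im| ≤ b → ‖G z‖ ≤ C * Real.exp (-|z.re|))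
    {b : ℝ} (hb0 : 0 ≤ b) (hb : b < a) :
    ∃ C, ∀ v : ℝ, ‖𝓕 (fun u : ℝ => G u) v‖ ≤ C * Real.exp (-(2 * Real.pi * b) * |v|) := by
  have h1 : ∀ φ : ℝ, |φ| < a → ∀ v, ‖𝓕 (fun u : ℝ => G u) v‖ ≤
      (∫ u : ℝ, ‖G (u - φ * I)‖) * Real.exp (-(2 * Real.pi * φ * v)) := by
    intro φ hφ v
    have h2 := fourier_horizontal_shift hd hdec hφ v
    have h3 : ‖𝓕 (fun u : ℝ => G (u - φ * I)) v‖ ≤ ∫ u : ℝ, ‖G (u - φ * I)‖ :=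
      VectorFourier.norm_fourierIntegral_le_integral_norm _ _ _ _ _
    rw [h2, norm_mul, norm_real, Real.norm_eq_abs, Real.abs_exp] at h3
    rw [Real.exp_neg, ← div_eq_mul_inv, le_div_iff₀ (Real.exp_pos _)]
    linarith
  refine ⟨max (∫ u : ℝ, ‖G (u - b * I)‖) (∫ u : ℝ, ‖G (u - (-b : ℝ) * I)‖), fun v => ?_⟩
  rcases le_total 0 v with hv | hv
  · refine (h1 b (by rwa [abs_of_nonneg hb0]) v).trans ?_
    rw [abs_of_nonneg hv, neg_mul]
    gcongr
    exact le_max_left _ _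
  · refine (h1 (-b) (by rwa [abs_neg, abs_of_nonneg hb0]) v).trans ?_
    rw [abs_of_nonpos hv]
    gcongr ?_ * Real.exp ?_
    · exact le_max_right _ _
    · linarith

lemma integrable_exp_mul_fourier (hd : DifferentiableOn ℂ G {z | |z.im| < a})
    (hdec : ∀ b < a, ∃ C, ∀ z : ℂ, |z.im| ≤ b → ‖G z‖ ≤ C * Real.exp (-|z.re|))
    {φ : ℝ} (hφ : |φ| < a) :
    Integrable fun v : ℝ => (Real.exp (2 * Real.pi * φ * v) : ℂ) * 𝓕 (fun u : ℝ => G u) v := by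
  obtain ⟨b, hb1, hb2⟩ := exists_between hφ
  obtain ⟨C, hC⟩ := norm_fourier_le_exp hd hdec ((abs_nonneg φ).trans hb1.le) hb2
  have ha : |(0 : ℝ)| < a := by rw [abs_zero]; exact (abs_nonneg φ).trans_lt hφ
  have hint : Integrable (fun u : ℝ => G u) := by
    simpa using integrable_horizontal hd hdec ha
  have hcont : Continuous (𝓕 (fun u : ℝ => G u)) :=
    VectorFourier.fourierIntegral_continuous Real.continuous_fourierChar
      (by exact continuous_inner) hint
  refine ((integrable_exp_neg_mul_abs (b := 2 * Real.pi * (b - |φ|))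
    (by have := Real.pi_pos; have : 0 < b - |φ| := by linarith
        positivity)).const_mul C).mono'
    (Continuous.aestronglyMeasurable (by fun_prop)) ?_
  filter_upwards with v
  have hC0 : 0 ≤ C := by
    have := (norm_nonneg _).trans (hC 0); simpa using this
  rw [norm_mul, norm_real, Real.norm_eq_abs, Real.abs_exp]
  calc _ ≤ Real.exp (2 * Real.pi * |φ| * |v|) * (C * Real.exp (-(2 * Real.pi * b) * |v|)) := by
        gcongr ?_ * ?_
        · refine Real.exp_le_exp.mpr ?_
          have : φ * v ≤ |φ| * |v| := by rw [← abs_mul]; exact le_abs_self _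
          nlinarith [Real.pi_pos]
        · exact hC v
    _ = C * (Real.exp (2 * Real.pi * |φ| * |v|) * Real.exp (-(2 * Real.pi * b) * |v|)) := by ring
    _ = _ := by rw [← Real.exp_add]; ring_nf

lemma eq_integral_fourier_horizontal (hd : DifferentiableOn ℂ G {z | |z.im| < a})
    (hdec : ∀ b < a, ∃ C, ∀ z : ℂ, |z.im| ≤ b → ‖G z‖ ≤ C * Real.exp (-|z.re|))
    {φ : ℝ} (hφ : |φ| < a) (u : ℝ) :
    G (u - φ * I) = ∫ v : ℝ, cexp (↑(2 * Real.pi * v * u) * I) *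
      ((Real.exp (2 * Real.pi * φ * v) : ℂ) * 𝓕 (fun u : ℝ => G u) v) := by
  have hF : 𝓕 (fun u : ℝ => G (u - φ * I)) =
      fun v => (Real.exp (2 * Real.pi * φ * v) : ℂ) * 𝓕 (fun u : ℝ => G u) v :=
    funext fun v => fourier_horizontal_shift hd hdec hφ v
  have := (continuous_horizontal hd hφ).fourierInv_fourier_eq (integrable_horizontal hd hdec hφ)
    (by rw [hF]; exact integrable_exp_mul_fourier hd hdec hφ)
  have h2 := congrFun this u
  rw [hF, Real.fourierInv_eq'] at h2
  rw [← h2]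
  simp [mul_assoc, mul_comm]

/-- If the Fourier transform of a holomorphic function on a strip has constant phase near `+∞`,
then boundedness of the function on a vertical segment implies boundedness on half the strip. -/
theorem bounded_of_fourier_phase (ha : 0 < a) (hd : DifferentiableOn ℂ G {z | |z.im| < a})
    (hdec : ∀ b < a, ∃ C, ∀ z : ℂ, |z.im| ≤ b → ‖G z‖ ≤ C * Real.exp (-|z.re|))
    {T : ℝ} {c : ℂ} (hc1 : ‖c‖ = 1)
    (hc : ∀ v > T, 𝓕 (fun u : ℝ => G u) v = c * ‖𝓕 (fun u : ℝ => G u) v‖)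
    {B : ℝ} (hB : ∀ φ : ℝ, 0 ≤ φ → φ < a → ‖G (-(φ * I))‖ ≤ B) :
    ∃ B', ∀ z : ℂ, -a < z.im → z.im ≤ 0 → ‖G z‖ ≤ B' := by
  set H := 𝓕 (fun u : ℝ => G u) with hH
  have hint : ∀ φ : ℝ, |φ| < a →
      Integrable fun v : ℝ => (Real.exp (2 * Real.pi * φ * v) : ℂ) * H v :=
    fun φ hφ => integrable_exp_mul_fourier hd hdec hφ
  have hnorm : ∀ φ v : ℝ, ‖(Real.exp (2 * Real.pi * φ * v) : ℂ) * H v‖ =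
      Real.exp (2 * Real.pi * φ * v) * ‖H v‖ := fun φ v => by
    rw [norm_mul, norm_real, Real.norm_eq_abs, Real.abs_exp]
  have hint' : ∀ φ : ℝ, |φ| < a → Integrable fun v : ℝ => Real.exp (2 * Real.pi * φ * v) * ‖H v‖ :=
    fun φ hφ => by simpa only [hnorm] using (hint φ hφ).norm
  have hint0 : Integrable fun v : ℝ => ‖H v‖ := by simpa using hint' 0 (by simpa using ha)
  set D := Real.exp (2 * Real.pi * (a * |T|)) * ∫ v, ‖H v‖ with hD
  have hleft : ∀ φ : ℝ, 0 ≤ φ → φ < a →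
      ∫ v in Iic T, Real.exp (2 * Real.pi * φ * v) * ‖H v‖ ≤ D := by
    intro φ h0 hφ
    have hφ' : |φ| < a := by rwa [abs_of_nonneg h0]
    calc _ ≤ ∫ v in Iic T, Real.exp (2 * Real.pi * (a * |T|)) * ‖H v‖ := by
          refine setIntegral_mono_on (hint' φ hφ').integrableOn
            (hint0.const_mul _).integrableOn measurableSet_Iic fun v (hv : v ≤ T) => ?_
          have : φ * v ≤ a * |T| := by
            calc φ * v ≤ φ * |T| := by gcongr; exact hv.trans (le_abs_self T)
              _ ≤ a * |T| := by gcongr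
          gcongr ?_ * _
          exact Real.exp_le_exp.mpr (by nlinarith [Real.pi_pos])
      _ ≤ ∫ v, Real.exp (2 * Real.pi * (a * |T|)) * ‖H v‖ :=
          setIntegral_le_integral (hint0.const_mul _) (.of_forall fun v => by positivity)
      _ = D := integral_const_mul _ _
  -- Inversion at `u = 0` has no oscillating factor. Beyond `T` the constant phase `c` comes out of
  -- the integral, so the norm of the integral is the integral of the norms; the part up to `T`
  -- costs at most `D`.
  have hright : ∀ φ : ℝ, 0 ≤ φ → φ < a →
      ∫ v in Ioi T, Real.exp (2 * Real.pi * φ * v) * ‖H v‖ ≤ B + D := by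
    intro φ h0 hφ
    have hφ' : |φ| < a := by rwa [abs_of_nonneg h0]
    have h1 := eq_integral_fourier_horizontal hd hdec hφ' 0
    simp only [ofReal_zero, zero_sub, mul_zero, zero_mul, Complex.exp_zero, one_mul, ← hH] at h1
    rw [← integral_add_compl (measurableSet_Iic (a := T)) (hint φ hφ'), compl_Iic] at h1
    have h2 : ∫ v in Ioi T, (Real.exp (2 * Real.pi * φ * v) : ℂ) * H v =
        c * (∫ v in Ioi T, Real.exp (2 * Real.pi * φ * v) * ‖H v‖ : ℝ) := by
      rw [← integral_complex_ofReal, ← integral_const_mul]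
      refine setIntegral_congr_fun measurableSet_Ioi fun v hv => ?_
      rw [hc v hv]
      simp [hc1]
      ring
    have h3 : 0 ≤ ∫ v in Ioi T, Real.exp (2 * Real.pi * φ * v) * ‖H v‖ :=
      integral_nonneg fun v => by positivity
    have h4 : ‖∫ v in Iic T, (Real.exp (2 * Real.pi * φ * v) : ℂ) * H v‖ ≤ D := by
      refine (norm_integral_le_integral_norm _).trans ?_
      simpa only [hnorm] using hleft φ h0 hφ
    calc _ = ‖∫ v in Ioi T, (Real.exp (2 * Real.pi * φ * v) : ℂ) * H v‖ := by
          rw [h2, norm_mul, hc1, one_mul, norm_real, Real.norm_of_nonneg h3]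
      _ = ‖G (-(φ * I)) - ∫ v in Iic T, (Real.exp (2 * Real.pi * φ * v) : ℂ) * H v‖ := by
          rw [h1, add_sub_cancel_left]
      _ ≤ B + D := (norm_sub_le _ _).trans (add_le_add (hB φ h0 hφ) h4)
  refine ⟨B + D + D, fun z hz1 hz2 => ?_⟩
  have h0 : 0 ≤ -z.im := by linarith
  have hφ : -z.im < a := by linarith
  have hφ' : |-z.im| < a := by rwa [abs_of_nonneg h0]
  have h1 := eq_integral_fourier_horizontal hd hdec hφ' z.re
  have hz : ((z.re : ℂ) - ((-z.im : ℝ) : ℂ) * I) = z := by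
    apply Complex.ext <;> simp
  rw [hz] at h1
  rw [h1]
  refine (norm_integral_le_integral_norm _).trans ?_
  have h2 : ∀ v : ℝ, ‖cexp (↑(2 * Real.pi * v * z.re) * I) *
      ((Real.exp (2 * Real.pi * -z.im * v) : ℂ) * H v)‖ =
      Real.exp (2 * Real.pi * -z.im * v) * ‖H v‖ := fun v => by
    rw [norm_mul, norm_exp_ofReal_mul_I, one_mul, hnorm]
  simp only [← hH, h2]
  rw [← integral_add_compl (measurableSet_Iic (a := T)) (hint' _ hφ'), compl_Iic]
  linarith [hleft _ h0 hφ, hright _ h0 hφ]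

end Strip

/-! ### Growth of cusp forms at the cusps -/

section Bounds

variable {Γ : Subgroup (GL (Fin 2) ℝ)} [Γ.IsArithmetic] {k : ℕ}

/-- A cusp form of weight `k` is bounded by a multiple of `(im τ)^(-k)`. -/
lemma CuspFormClass.exists_norm_le_div_im_pow {F : Type*} [FunLike F ℍ ℂ]
    [CuspFormClass F Γ (k : ℤ)] (f : F) : ∃ C, ∀ τ : ℍ, ‖f τ‖ ≤ C / τ.im ^ k := by
  obtain ⟨C₁, hC₁⟩ := CuspFormClass.exists_bound f
  obtain ⟨c, hc, hO⟩ := CuspFormClass.exp_decay_atImInfty' (Γ := Γ) (k := k) f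
  obtain ⟨C₂, hC₂0, hC₂⟩ := hO.exists_pos
  rw [Asymptotics.IsBigOWith, UpperHalfPlane.atImInfty, eventually_comap, eventually_atTop] at hC₂
  obtain ⟨A, hA⟩ := hC₂
  have hC₁0 : 0 ≤ C₁ := by
    have := (norm_nonneg _).trans (hC₁ UpperHalfPlane.I)
    simpa using this
  -- Above height `A` the exponential decay beats `c ^ k y ^ k / k!`; below it the Hecke bound `y ^
  -- (-k/2)` loses only a bounded factor.
  refine ⟨max (C₂ * (k.factorial / c ^ k)) (C₁ * (max A 1) ^ k), fun τ => ?_⟩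
  have hτ := τ.im_pos
  rcases le_total A τ.im with h | h
  · refine (hA _ h τ rfl).trans ?_
    rw [Real.norm_of_nonneg (Real.exp_pos _).le, le_div_iff₀ (by positivity)]
    refine le_trans ?_ (le_max_left _ _)
    have h1 := Real.pow_div_factorial_le_exp (c * τ.im) (by positivity) k
    rw [neg_mul, Real.exp_neg, mul_assoc]
    gcongr
    rw [inv_mul_eq_div, div_le_div_iff₀ (Real.exp_pos _) (by positivity)]
    rw [div_le_iff₀ (by positivity), mul_pow] at h1
    linarith
  · refine (hC₁ τ).trans ?_
    rw [div_le_div_iff₀ (by positivity) (by positivity)]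
    have h1 : τ.im ^ k = τ.im ^ ((k : ℝ) / 2) * τ.im ^ ((k : ℝ) / 2) := by
      rw [← Real.rpow_add hτ, add_halves, Real.rpow_natCast]
    have h2 : τ.im ^ ((k : ℝ) / 2) ≤ max A 1 ^ k := by
      calc τ.im ^ ((k : ℝ) / 2) ≤ max A 1 ^ ((k : ℝ) / 2) := by
            gcongr; exact h.trans (le_max_left _ _)
        _ ≤ max A 1 ^ (k : ℝ) :=
            Real.rpow_le_rpow_of_exponent_le (le_max_right _ _)
              (by have : (0 : ℝ) ≤ k := k.cast_nonneg
                  linarith)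
        _ = _ := Real.rpow_natCast _ _
    calc C₁ * τ.im ^ k = C₁ * τ.im ^ ((k : ℝ) / 2) * τ.im ^ ((k : ℝ) / 2) := by rw [h1]; ring
      _ ≤ C₁ * (max A 1 ^ k) * τ.im ^ ((k : ℝ) / 2) := by gcongr
      _ ≤ _ := by
          push_cast
          gcongr
          exact le_max_right _ _

open ConjAct Pointwise in
/-- A cusp form of weight `k` is bounded in nontangential approach regions of a cusp. -/
lemma CuspForm.exists_norm_le_cusp (f : CuspForm Γ (k : ℤ)) (r : ℚ) :
    ∃ C, ∀ τ : ℍ, ‖f τ‖ ≤ C * (‖(τ : ℂ) - r‖ / τ.im) ^ k := by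
  -- `γ` maps `∞` to `r`. The translate of `f` by `γ` is a cusp form for a conjugate group, which is
  -- still arithmetic, so the previous bound applies to it.
  obtain ⟨γ, h0, h1⟩ := (Rat.isCoprime_num_den r).exists_SL2_col 0
  have harith : (toConjAct (γ : GL (Fin 2) ℝ)⁻¹ • Γ).IsArithmetic := by
    simpa [(show Rat.castHom ℝ = algebraMap ℚ ℝ by rfl), map_inv,
      Matrix.SpecialLinearGroup.map_mapGL]
      using! Subgroup.IsArithmetic.conj Γ (Matrix.SpecialLinearGroup.mapGL ℚ γ)⁻¹
  obtain ⟨C, hC⟩ := CuspFormClass.exists_norm_le_div_im_pow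
    (Γ := toConjAct (γ : GL (Fin 2) ℝ)⁻¹ • Γ) (CuspForm.translate f γ)
  refine ⟨C * (r.den : ℝ) ^ k, fun τ => ?_⟩
  set τ' := γ⁻¹ • τ with hτ'
  have e1 : γ • τ' = τ := by rw [hτ', smul_inv_smul]
  have hcoe := UpperHalfPlane.coe_specialLinearGroup_apply γ τ'
  rw [e1] at hcoe
  have him := ModularGroup.im_smul_eq_div_normSq γ τ'
  rw [e1] at him
  have hne := UpperHalfPlane.denom_ne_zero γ τ'
  have hC' := hC τ'
  rw [CuspForm.coe_translate, ModularForm.SL_slash_apply, e1] at hC'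
  have hden := ModularGroup.denom_apply γ τ'
  set D := UpperHalfPlane.denom γ τ' with hD
  have hDpos : 0 < ‖D‖ := norm_pos_iff.mpr hne
  have hrpos : (0 : ℝ) < r.den := by exact_mod_cast r.pos
  have hrne : (r.den : ℂ) ≠ 0 := by exact_mod_cast r.pos.ne'
  rw [norm_mul, norm_zpow, zpow_neg, zpow_natCast, ← div_eq_mul_inv,
    div_le_iff₀ (by positivity)] at hC'
  have hdet : (γ 0 0 : ℂ) * γ 1 1 - γ 0 1 * γ 1 0 = 1 := by
    have := γ.det_coe
    rw [Matrix.det_fin_two] at this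
    exact_mod_cast this
  -- The difference of `γ τ'` and `γ ∞`, computed from `det γ = 1`.
  have hsub : (τ : ℂ) - r = -1 / (r.den * D) := by
    have hr : (r : ℂ) = γ 0 0 / γ 1 0 := by
      rw [h0, h1]
      conv_lhs => rw [← Rat.num_div_den r]
      push_cast
      ring
    have h1' : (γ 1 0 : ℂ) = r.den := by rw [h1]; norm_cast
    simp only [algebraMap_int_eq, eq_intCast, ofReal_intCast] at hcoe
    rw [hcoe, ← hden, hr, ← h1', div_sub_div _ _ hne (by rwa [h1']),
      div_eq_div_iff (mul_ne_zero hne (by rwa [h1'])) (mul_ne_zero (by rwa [h1']) hne), hden]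
    linear_combination -(γ 1 0 : ℂ) * ((γ 1 0 : ℂ) * τ' + γ 1 1) * hdet
  have hnorm : ‖(τ : ℂ) - r‖ = 1 / (r.den * ‖D‖) := by
    rw [hsub, norm_div, norm_neg, norm_one, norm_mul, norm_natCast]
  have him' : τ'.im = τ.im * ‖D‖ ^ 2 := by
    rw [him, Complex.normSq_eq_norm_sq]
    field_simp
  refine hC'.trans (le_of_eq ?_)
  rw [hnorm, him']
  have := τ.im_pos.ne'
  simp only [div_pow, mul_pow, one_pow]
  field_simp
  ring

end Bounds

/-! ### Modularity and Fourier coefficients at level `N` -/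

section Level

variable {N : ℕ} {k : ℕ} (f : CuspFormGamma0 N k)

lemma CuspFormGamma0.smul_eq {γ : SL(2, ℤ)} (hγ : γ ∈ CongruenceSubgroup.Gamma0 N) (τ : ℍ) :
    f (γ • τ) = ((γ 1 0 : ℂ) * τ + (γ 1 1 : ℂ)) ^ k * f τ := by
  have := SlashInvariantForm.slash_action_eqn_SL'' (k := k) f hγ τ
  rw [this, ModularGroup.denom_apply]
  norm_cast

lemma CuspFormGamma0.periodic : Function.Periodic (f ∘ ofComplex) 1 := by
  have := SlashInvariantFormClass.periodic_comp_ofComplex (h := 1) f (by simp)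
  simpa using this

lemma CuspFormGamma0.differentiableOn : DifferentiableOn ℂ (f ∘ ofComplex) {z | 0 < z.im} :=
  UpperHalfPlane.mdifferentiable_iff.mp (CuspFormClass.holo f)

/-- The `q`-expansion coefficients in terms of the normalized Fourier coefficients. -/
lemma HasNormalizedFourierExpansion.coeff_eq {a : ℕ → ℂ}
    (hf : HasNormalizedFourierExpansion k f a) {n : ℕ} (hn : 0 < n) :
    (UpperHalfPlane.qExpansion 1 f).coeff n = a n * (((n : ℝ) ^ (((k : ℝ) - 1) / 2) : ℝ) : ℂ) := by
  have h := ModularFormClass.qExpansion_coeff_unique (h := 1) (f := f) one_pos (by simp)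
    (c := fun n => if n = 0 then 0 else a n * (((n : ℝ) ^ (((k : ℝ) - 1) / 2) : ℝ) : ℂ))
    (fun τ => by
      rw [← PNat.coe_injective.hasSum_iff]
      · convert hf τ using 2 with n
        simp only [Function.comp_apply, PNat.ne_zero, if_false, smul_eq_mul,
          Function.Periodic.qParam, ← Complex.exp_nat_mul]
        congr 2
        push_cast
        ring
      · intro n hn
        have : n = 0 := by
          by_contra h
          exact hn ⟨⟨n, Nat.pos_of_ne_zero h⟩, rfl⟩
        simp [this]) n
  rw [← h]
  simp [hn.ne']

/-- If the Fourier coefficients are real, then `f (-conj z) = conj (f z)`. -/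
lemma HasNormalizedFourierExpansion.conj_apply {f : ℍ → ℂ} {a : ℕ → ℝ}
    (hf : HasNormalizedFourierExpansion k f (fun n => (a n : ℂ))) {z : ℂ} (hz : 0 < z.im) :
    f (ofComplex (-conj z)) = conj (f (ofComplex z)) := by
  have hz' : 0 < (-conj z).im := by simpa using hz
  have h1 := hf (ofComplex (-conj z))
  have h2 := hf (ofComplex z)
  rw [← Complex.hasSum_conj'] at h2
  refine h1.unique ?_
  convert h2 using 2 with n
  rw [UpperHalfPlane.ofComplex_apply_of_im_pos hz, UpperHalfPlane.ofComplex_apply_of_im_pos hz']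
  simp only [map_mul, conj_ofReal, ← Complex.exp_conj, conj_I, map_natCast, map_ofNat]
  congr 2
  ring

end Level

/-! ### Vanishing criterion and functional equation -/

section Level

variable {N : ℕ} {k : ℕ} (f : CuspFormGamma0 N k)

/-- A cusp form which is bounded on a half-plane `re τ ≤ x` vanishes. -/
lemma CuspFormGamma0.eq_zero_of_bounded (hN : 0 < N) (hk : 0 < k) {x B : ℝ}
    (hB : ∀ τ : ℍ, τ.re ≤ x → ‖f τ‖ ≤ B) (τ : ℍ) : f τ = 0 := by
  by_contra hne
  have hpos : 0 < ‖f τ‖ := norm_pos_iff.mpr hne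
  have hy := τ.im_pos
  -- The size of `n` ensures `‖D‖ > 1`, `‖τ‖ ≤ ‖D‖` and `‖D‖ * ‖f τ‖ > B` for the automorphy factor
  -- `D = N n τ + 1`.
  obtain ⟨n, hn⟩ := exists_nat_gt (max (max (1 / τ.im) (‖(τ : ℂ)‖ / τ.im)) (B / ‖f τ‖ / τ.im))
  rw [max_lt_iff, max_lt_iff, div_lt_iff₀ hy, div_lt_iff₀ hy, div_lt_iff₀ hy,
    div_lt_iff₀ hpos] at hn
  obtain ⟨⟨hn1, hn2⟩, hn3⟩ := hn
  -- The matrix below moves `τ` to `j + τ / D`, whose real part is at most `j + 1 ≤ x`.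
  set j : ℤ := ⌊x⌋ - 1
  have hdet : (!![1 + j * (N * n), j; N * n, 1] : Matrix (Fin 2) (Fin 2) ℤ).det = 1 := by
    rw [Matrix.det_fin_two_of]; ring
  let γ : SL(2, ℤ) := ⟨_, hdet⟩
  have hγ : γ ∈ CongruenceSubgroup.Gamma0 N := by
    rw [CongruenceSubgroup.Gamma0_mem]
    simp [γ]
  have h1 : f (γ • τ) = ((N * n : ℂ) * τ + 1) ^ k * f τ := by
    rw [CuspFormGamma0.smul_eq f hγ]; simp [γ]
  set D : ℂ := (N * n : ℂ) * τ + 1 with hD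
  have hDn : n * τ.im ≤ ‖D‖ := by
    have h2 : D.im = N * n * τ.im := by simp [hD]
    have hN1 : (1 : ℝ) ≤ N := by exact_mod_cast hN
    calc n * τ.im ≤ N * (n * τ.im) := le_mul_of_one_le_left (by positivity) hN1
      _ = D.im := by rw [h2]; ring
      _ ≤ ‖D‖ := (le_abs_self _).trans (abs_im_le_norm D)
  have hD1 : 1 < ‖D‖ := hn1.trans_le hDn
  have hD0 : D ≠ 0 := norm_pos_iff.mp (one_pos.trans hD1)
  have hcoe : ((γ • τ : ℍ) : ℂ) = j + τ / D := by
    rw [UpperHalfPlane.coe_specialLinearGroup_apply]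
    have e : (↑((algebraMap ℤ ℝ) (γ 1 0)) * (τ : ℂ) + ↑((algebraMap ℤ ℝ) (γ 1 1))) = D := by
      simp [γ, hD]
    rw [e, eq_comm, eq_div_iff hD0, add_mul, div_mul_cancel₀ _ hD0]
    simp [γ, hD]
    ring
  have hre : (γ • τ : ℍ).re ≤ x := by
    have h2 : (γ • τ : ℍ).re = j + ((τ : ℂ) / D).re := by
      rw [← UpperHalfPlane.coe_re, hcoe]; simp
    have h3 : ((τ : ℂ) / D).re ≤ 1 := by
      refine (re_le_norm _).trans ?_
      rw [norm_div, div_le_one (one_pos.trans hD1)]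
      exact hn2.le.trans hDn
    have h4 : (j : ℝ) = ⌊x⌋ - 1 := by simp [j]
    rw [h2, h4]
    linarith [Int.floor_le x]
  have h5 := hB _ hre
  rw [h1, norm_mul, norm_pow] at h5
  have h6 : ‖D‖ ≤ ‖D‖ ^ k := le_self_pow₀ hD1.le hk.ne'
  have h7 : B < ‖D‖ ^ k * ‖f τ‖ :=
    hn3.trans_le (mul_le_mul_of_nonneg_right (hDn.trans h6) hpos.le)
  linarith

/-- Both `p/q` and the first column of `γ` are in lowest terms, so they agree up to a sign `σ`. The
congruence `p² ≡ 1` says that `p` is its own inverse mod `q`, so the determinant forces the lower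
right entry to be `σ p` mod `q`. -/
lemma IsGamma0EquivInfty.exists_mem_gamma0 {p : ℤ} {q : ℕ} (hq : 0 < q)
    (hpq : IsGamma0EquivInfty N ((p : ℝ) / (q : ℝ))) (hp : p ^ 2 ≡ 1 [ZMOD (q : ℤ)]) :
    ∃ γ ∈ CongruenceSubgroup.Gamma0 N, ∃ σ l : ℤ, σ * σ = 1 ∧ γ 0 0 = σ * p ∧ γ 1 0 = σ * q ∧
      γ 1 1 = σ * p + l * q := by
  obtain ⟨γ, hγ, h⟩ := hpq
  refine ⟨γ, hγ, ?_⟩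
  obtain ⟨t, ht⟩ := hp.symm.dvd
  have hdet : γ 0 0 * γ 1 1 - γ 0 1 * γ 1 0 = 1 := by
    have := γ.det_coe
    rwa [Matrix.det_fin_two] at this
  have hqR : (q : ℝ) ≠ 0 := by exact_mod_cast hq.ne'
  have hq0 : (q : ℤ) ≠ 0 := by exact_mod_cast hq.ne'
  rw [OnePoint.smul_infty_eq_ite] at h
  have hc : γ 1 0 ≠ 0 := by
    intro hc
    simp [hc] at h
  have hcR : (γ 1 0 : ℝ) ≠ 0 := by exact_mod_cast hc
  have hac : γ 0 0 * q = p * γ 1 0 := by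
    have h' : (γ 0 0 : ℝ) / γ 1 0 = p / q := by
      simp [hc] at h
      exact_mod_cast h
    rw [div_eq_div_iff hcR hqR] at h'
    exact_mod_cast h'
  have hcop : IsCoprime (q : ℤ) p := ⟨-t, p, by linarith⟩
  have hcop' : IsCoprime (γ 1 0) (γ 0 0) := ⟨-γ 0 1, γ 1 1, by linarith⟩
  have d1 : (q : ℤ) ∣ γ 1 0 := hcop.dvd_of_dvd_mul_left ⟨γ 0 0, by linarith⟩
  have d2 : γ 1 0 ∣ (q : ℤ) := hcop'.dvd_of_dvd_mul_left ⟨p, by linarith⟩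
  obtain ⟨σ, hσ, hσ'⟩ : ∃ σ : ℤ, σ * σ = 1 ∧ γ 1 0 = σ * q := by
    rcases Int.associated_iff.mp (associated_of_dvd_dvd d2 d1) with h | h
    · exact ⟨1, by norm_num, by rw [h]; ring⟩
    · exact ⟨-1, by norm_num, by rw [h]; ring⟩
  have ha : γ 0 0 = σ * p := by
    apply mul_right_cancel₀ hq0
    rw [hac, hσ']; ring
  -- Found by multiplying the determinant relation by `σ p` and substituting `p² = 1 + q t`.
  refine ⟨σ, p * γ 0 1 - γ 1 1 * t, hσ, ha, hσ', ?_⟩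
  rw [ha, hσ'] at hdet
  linear_combination σ * p * hdet - γ 1 1 * ht - (p * p * γ 1 1 - p * γ 0 1 * q) * hσ

/-- The functional equation of a cusp form with real Fourier coefficients along the vertical line
through `p / q`. -/
lemma CuspFormGamma0.functional_equation (hk : Even k) {p : ℤ} {q : ℕ} (hq : 0 < q)
    (hpq : IsGamma0EquivInfty N ((p : ℝ) / (q : ℝ))) (hp : p ^ 2 ≡ 1 [ZMOD (q : ℤ)])
    {a : ℕ → ℝ} (hf : HasNormalizedFourierExpansion k f (fun n => (a n : ℂ)))
    {t : ℝ} (ht : 0 < t) :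
    f (ofComplex (p / q + I * (1 / t : ℝ) / q)) =
      (I * t) ^ k * conj (f (ofComplex (p / q + I * t / q))) := by
  obtain ⟨γ, hγ, σ, l, hσ, ha, hc, hd⟩ := hpq.exists_mem_gamma0 hq hp
  have hqC : (q : ℂ) ≠ 0 := by exact_mod_cast hq.ne'
  have hqR : (0 : ℝ) < q := by exact_mod_cast hq
  have htC : (t : ℂ) ≠ 0 := by exact_mod_cast ht.ne'
  have hσC : (σ : ℂ) * σ = 1 := by exact_mod_cast hσ
  have hσ0 : (σ : ℂ) ≠ 0 := left_ne_zero_of_mul_eq_one hσC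
  have him : ∀ (x : ℝ) {s : ℝ}, 0 < s → 0 < (x + I * s / q : ℂ).im := by
    intro x s hs
    have : (x + I * s / q : ℂ).im = s / q := by
      rw [show (x + I * s / q : ℂ) = x + ((s / q : ℝ) : ℂ) * I by push_cast; ring]
      simp
    rw [this]; positivity
  have him1 : 0 < (-(p / q) - σ * l + I * t / q : ℂ).im := by
    simpa using him (-(p / q) - σ * l) ht
  have him2 : 0 < (p / q + I * t / q : ℂ).im := by simpa using him (p / q) ht
  -- Up to the integer `σ l`, this is the reflection `-conj` of the point at height `t / q` over
  -- `p/q`; the shift makes the automorphy factor exactly `σ i t`.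
  set z : ℍ := ⟨_, him1⟩ with hz
  have hzc : (z : ℂ) = -(p / q) - σ * l + I * t / q := rfl
  have hden : (γ 1 0 : ℂ) * z + γ 1 1 = σ * (I * t) := by
    rw [hc, hd, hzc]
    push_cast
    field_simp
    linear_combination (-(l : ℂ) * q) * hσC
  have hdet : (γ 0 0 : ℂ) * γ 1 1 - γ 0 1 * γ 1 0 = 1 := by
    have := γ.det_coe
    rw [Matrix.det_fin_two] at this
    exact_mod_cast this
  have hsmul : γ • z = ofComplex (p / q + I * (1 / t : ℝ) / q) := by
    have him3 : 0 < (p / q + I * (1 / t : ℝ) / q : ℂ).im := by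
      simpa using him (p / q) (one_div_pos.mpr ht)
    rw [UpperHalfPlane.ofComplex_apply_of_im_pos him3]
    apply UpperHalfPlane.ext
    rw [UpperHalfPlane.coe_specialLinearGroup_apply]
    simp only [algebraMap_int_eq, eq_intCast, ofReal_intCast]
    rw [hden, div_eq_iff (mul_ne_zero hσ0 (mul_ne_zero I_ne_zero htC))]
    have e : (γ 1 0 : ℂ) * ((γ 0 0 : ℂ) * z + γ 0 1) = γ 0 0 * (σ * (I * t)) - 1 := by
      rw [← hden]; linear_combination -hdet
    have hc' : (γ 1 0 : ℂ) = σ * q := by rw [hc]; push_cast; ring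
    have ha' : (γ 0 0 : ℂ) = σ * p := by rw [ha]; push_cast; ring
    apply mul_left_cancel₀ (show (γ 1 0 : ℂ) ≠ 0 by rw [hc']; exact mul_ne_zero hσ0 hqC)
    rw [e, hc', ha']
    push_cast
    field_simp
    linear_combination -I ^ 2 * hσC - I_sq
  rw [← hsmul, CuspFormGamma0.smul_eq f hγ, hden, mul_pow]
  have hσk : (σ : ℂ) ^ k = 1 := by
    obtain ⟨m, rfl⟩ := hk
    rw [← two_mul, pow_mul, sq, hσC, one_pow]
  rw [hσk, one_mul, ← hf.conj_apply him2]
  congr 1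
  have hper := (CuspFormGamma0.periodic f).sub_zsmul_eq (x := -(p / q) + I * t / q) (σ * l)
  simp only [Function.comp_apply] at hper
  have e2 : -conj (p / q + I * t / q : ℂ) = -(p / q) + I * t / q := by
    simp; ring
  rw [e2, ← hper, ← UpperHalfPlane.ofComplex_apply z, hzc]
  congr 2
  simp
  ring

end Level

lemma im_vertical (x q : ℝ) (w : ℂ) : (x + I * w / q : ℂ).im = w.re / q := by
  rw [add_im, ofReal_im, zero_add, div_ofReal_im]
  simp

/-! ### The form in the logarithmic coordinate -/

section Level

variable {N : ℕ} {k : ℕ} (f : CuspFormGamma0 N k)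

/-- The restriction of `f` to the vertical line through `x`, in the logarithmic coordinate
`z = x + i exp(-ζ) / q`, normalized by the factor `exp(-mζ)`. -/
noncomputable def CuspFormGamma0.logVertical (m : ℕ) (x q : ℝ) (ζ : ℂ) : ℂ :=
  cexp (-m * ζ) * f (ofComplex (x + I * cexp (-ζ) / q))

lemma exp_neg_re_pos {ζ : ℂ} (h : |ζ.im| < Real.pi / 2) : 0 < (cexp (-ζ)).re := by
  rw [exp_re, neg_im, Real.cos_neg]
  have := Real.cos_pos_of_mem_Ioo (abs_lt.mp h)
  positivity

lemma CuspFormGamma0.differentiableOn_logVertical (m : ℕ) (x : ℝ) {q : ℝ} (hq : 0 < q) :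
    DifferentiableOn ℂ (logVertical f m x q) {z | |z.im| < Real.pi / 2} := by
  unfold logVertical
  refine DifferentiableOn.mul (by fun_prop) ?_
  refine (CuspFormGamma0.differentiableOn f).comp (f := fun ζ => x + I * cexp (-ζ) / q)
    (by fun_prop) fun ζ hζ => ?_
  rw [mem_ofPred_eq, im_vertical]
  exact div_pos (exp_neg_re_pos hζ) hq

/-- As `re z → +∞` the point tends nontangentially to the cusp `p/q`, where `f` is bounded and
`exp(-mz)` decays. As `re z → -∞`, the bound `(im τ)^(-k)` contributes `exp(2m re z)`, leaving
`exp(m re z)`. -/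
lemma CuspFormGamma0.logVertical_decay (hN : 0 < N) {m : ℕ} (hm : 0 < m) (hk : k = 2 * m)
    (p : ℤ) {q : ℕ} (hq : 0 < q) {b : ℝ} (hb : b < Real.pi / 2) :
    ∃ C, ∀ z : ℂ, |z.im| ≤ b → ‖logVertical f m (p / q) q z‖ ≤ C * Real.exp (-|z.re|) := by
  have : NeZero N := ⟨hN.ne'⟩
  rcases lt_or_ge b 0 with hb0 | hb0
  · exact ⟨0, fun z hz => absurd ((abs_nonneg _).trans hz) (not_le.mpr hb0)⟩
  have hqR : (0 : ℝ) < q := by exact_mod_cast hq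
  have hcos : 0 < Real.cos b := Real.cos_pos_of_mem_Ioo ⟨by linarith [Real.pi_pos], hb⟩
  obtain ⟨C₁, h₁⟩ := CuspFormClass.exists_norm_le_div_im_pow (k := k) f
  obtain ⟨C₂, h₂⟩ := CuspForm.exists_norm_le_cusp f ((p : ℚ) / q)
  have hC₁ : 0 ≤ C₁ := by
    have := (norm_nonneg _).trans (h₁ UpperHalfPlane.I)
    simpa using this
  refine ⟨max (C₁ * (q / Real.cos b) ^ k) (|C₂| * (1 / Real.cos b) ^ k), fun z hz => ?_⟩
  have hre := exp_neg_re_pos (hz.trans_lt hb)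
  have hre2 : Real.exp (-z.re) * Real.cos b ≤ (cexp (-z)).re := by
    rw [exp_re, neg_im, neg_re, Real.cos_neg, ← Real.cos_abs z.im]
    gcongr
    exact Real.cos_le_cos_of_nonneg_of_le_pi (abs_nonneg _) (by linarith [Real.pi_pos]) hz
  have him := im_vertical (p / q) q (cexp (-z))
  have hpos : 0 < (((p / q : ℝ) : ℂ) + I * cexp (-z) / (q : ℝ) : ℂ).im := by
    rw [him]; positivity
  set τ : ℍ := ⟨_, hpos⟩ with hτ
  have hτim : τ.im = (cexp (-z)).re / q := him
  have hτim' : Real.exp (-z.re) * Real.cos b / q ≤ τ.im := by rw [hτim]; gcongr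
  have hG : ‖logVertical f m (p / q) q z‖ = Real.exp (-m * z.re) * ‖f τ‖ := by
    rw [logVertical, norm_mul, UpperHalfPlane.ofComplex_apply_of_im_pos hpos, norm_exp]
    congr 2
    simp
  have hdist : ‖(τ : ℂ) - ((p : ℚ) / q : ℚ)‖ = Real.exp (-z.re) / q := by
    have : (τ : ℂ) - ((p : ℚ) / q : ℚ) = I * cexp (-z) / (q : ℝ) := by
      rw [hτ]; push_cast; ring
    rw [this, norm_div, norm_mul, norm_I, one_mul, norm_exp, norm_real, neg_re,
      Real.norm_of_nonneg hqR.le]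
  have hm1 : (1 : ℝ) ≤ m := by exact_mod_cast hm
  rw [hG]
  rcases le_total 0 z.re with h0 | h0
  · have h3 : ‖f τ‖ ≤ |C₂| * (1 / Real.cos b) ^ k := by
      have hτpos := τ.im_pos
      refine (h₂ τ).trans (mul_le_mul (le_abs_self _) (pow_le_pow_left₀ (by positivity) ?_ k)
        (by positivity) (abs_nonneg _))
      rw [hdist, div_le_div_iff₀ τ.im_pos hcos]
      calc Real.exp (-z.re) / q * Real.cos b = Real.exp (-z.re) * Real.cos b / q := by ring
        _ ≤ 1 * τ.im := by rw [one_mul]; exact hτim'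
    calc _ ≤ Real.exp (-|z.re|) * (|C₂| * (1 / Real.cos b) ^ k) := by
          gcongr
          rw [abs_of_nonneg h0]; nlinarith
      _ ≤ _ := by
          rw [mul_comm]
          gcongr
          exact le_max_right _ _
  · have h3 : ‖f τ‖ ≤ C₁ * (q / Real.cos b) ^ k * Real.exp (k * z.re) := by
      refine (h₁ τ).trans ?_
      calc C₁ / τ.im ^ k ≤ C₁ / (Real.exp (-z.re) * Real.cos b / q) ^ k := by gcongr
        _ = _ := by
          rw [Real.exp_neg, Real.exp_nat_mul]
          simp only [div_pow, mul_pow, inv_pow]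
          field_simp
    calc _ ≤ Real.exp (-m * z.re) * (C₁ * (q / Real.cos b) ^ k * Real.exp (k * z.re)) := by gcongr
      _ = (C₁ * (q / Real.cos b) ^ k) * Real.exp (m * z.re) := by
          rw [mul_left_comm, ← Real.exp_add, hk]
          congr 2; push_cast; ring
      _ ≤ _ := by
          gcongr
          · exact le_max_left _ _
          · rw [abs_of_nonpos h0]; nlinarith

lemma CuspFormGamma0.logVertical_bounded (hN : 0 < N) (m : ℕ) (p : ℤ) {q : ℕ} (hq : 0 < q) :
    ∃ B, ∀ φ : ℝ, 0 ≤ φ → φ < Real.pi / 2 → ‖logVertical f m (p / q) q (-(φ * I))‖ ≤ B := by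
  have : NeZero N := ⟨hN.ne'⟩
  have hqR : (0 : ℝ) < q := by exact_mod_cast hq
  obtain ⟨C, hC⟩ := CuspForm.exists_norm_le_cusp f (((p : ℚ) - 1) / q)
  refine ⟨|C| * 2 ^ k, fun φ h0 hφ => ?_⟩
  have hcos : 0 < Real.cos φ := Real.cos_pos_of_mem_Ioo ⟨by linarith [Real.pi_pos], hφ⟩
  have hsin : 0 ≤ Real.sin φ := Real.sin_nonneg_of_nonneg_of_le_pi h0 (by linarith [Real.pi_pos])
  have hre : (cexp (-(-(φ * I)))).re = Real.cos φ := by rw [neg_neg, exp_ofReal_mul_I_re]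
  have him := im_vertical (p / q) q (cexp (-(-(φ * I))))
  rw [hre] at him
  have hpos : 0 < (((p / q : ℝ) : ℂ) + I * cexp (-(-(φ * I))) / (q : ℝ) : ℂ).im := by
    rw [him]; positivity
  rw [logVertical, norm_mul, UpperHalfPlane.ofComplex_apply_of_im_pos hpos, norm_exp]
  set τ : ℍ := ⟨_, hpos⟩ with hτ
  have hτim : τ.im = Real.cos φ / q := him
  -- Nontangential approach: `(1 - sin φ)² + cos² φ = 2(1 - sin φ) ≤ 2 cos² φ`, because `sin φ ≥ 0`.
  have hdist : ‖(τ : ℂ) - (((p : ℚ) - 1) / q : ℚ)‖ ≤ 2 * τ.im := by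
    have e : (τ : ℂ) - (((p : ℚ) - 1) / q : ℚ) =
        ((1 - Real.sin φ : ℝ) + (Real.cos φ : ℝ) * I) / (q : ℝ) := by
      rw [hτ]
      simp only [neg_neg, exp_mul_I]
      push_cast
      linear_combination (Complex.sin φ / q) * I_sq
    rw [e, norm_div, norm_real, Real.norm_of_nonneg hqR.le, hτim, ← mul_div_assoc]
    gcongr
    rw [norm_add_mul_I]
    refine Real.sqrt_le_iff.mpr ⟨by positivity, ?_⟩
    nlinarith [Real.sin_sq_add_cos_sq φ, Real.sin_le_one φ]
  have h2 : (-(m : ℂ) * -(φ * I)).re = 0 := by simp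
  rw [h2, Real.exp_zero, one_mul]
  refine (hC τ).trans ?_
  have := τ.im_pos
  calc _ ≤ |C| * (‖(τ : ℂ) - (((p : ℚ) - 1) / q : ℚ)‖ / τ.im) ^ k := by
        gcongr; exact le_abs_self C
    _ ≤ |C| * 2 ^ k := by
        gcongr
        rwa [div_le_iff₀ this]

/-- With `w = exp(-z)` the half-strip becomes the quadrant `re w > 0`, `im w ≥ 0`, and the bounded
function has norm `‖w‖ ^ m * ‖f‖`. Where `‖w‖ ≥ 1` this bounds `f` itself. -/
lemma CuspFormGamma0.eq_zero_of_logVertical_bounded (hN : 0 < N) (hk : 0 < k) (m : ℕ) (p : ℤ)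
    {q : ℕ} (hq : 0 < q) {B : ℝ}
    (hB : ∀ z : ℂ, -(Real.pi / 2) < z.im → z.im ≤ 0 → ‖logVertical f m (p / q) q z‖ ≤ B) (τ : ℍ) :
    f τ = 0 := by
  have hqR : (0 : ℝ) < q := by exact_mod_cast hq
  have hqC : (q : ℂ) ≠ 0 := by exact_mod_cast hq.ne'
  refine eq_zero_of_bounded f hN hk (x := (p - 1) / q) (B := B) (fun τ hτ => ?_) τ
  -- Solves `p/q + I * w / q = τ`; then `re τ ≤ (p - 1)/q` is the condition `im w ≥ 1`.
  set w : ℂ := -I * (q * τ - p) with hw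
  have hre : w.re = q * τ.im := by simp [hw]
  have him : w.im = p - q * τ.re := by simp [hw]
  have hre0 : 0 < w.re := by rw [hre]; exact mul_pos hqR τ.im_pos
  have him1 : 1 ≤ w.im := by
    rw [him]
    rw [le_div_iff₀ hqR] at hτ
    linarith
  have hw0 : w ≠ 0 := fun h => by simp [h] at hre0
  have hw1 : 1 ≤ ‖w‖ := him1.trans ((le_abs_self _).trans (abs_im_le_norm w))
  have h1 := hB (-log w)
    (by rw [neg_im, log_im, neg_lt_neg_iff]
        exact (abs_lt.mp (abs_arg_lt_pi_div_two_iff.mpr (Or.inl hre0))).2)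
    (by rw [neg_im, log_im, neg_nonpos, arg_nonneg_iff]; linarith)
  rw [logVertical, neg_neg, exp_log hw0, neg_mul_neg, exp_nat_mul, exp_log hw0, norm_mul,
    norm_pow] at h1
  have e : (((p / q : ℝ) : ℂ) + I * w / (q : ℝ) : ℂ) = τ := by
    rw [hw]
    push_cast
    field_simp
    linear_combination (p - (q : ℂ) * τ) * I_sq
  rw [e, UpperHalfPlane.ofComplex_apply] at h1
  exact (le_mul_of_one_le_left (norm_nonneg _) (one_le_pow₀ hw1)).trans h1

end Level

/-- A continuous function that is real or purely imaginary has constant phase on a half-line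
without zeros. -/
lemma exists_phase {H : ℝ → ℂ} (hH : Continuous H) {ε : ℂ} (hε : ε = 1 ∨ ε = -1)
    (hconj : ∀ v, conj (H v) = ε * H v) {T : ℝ} (hne : ∀ v > T, H v ≠ 0) :
    ∃ c : ℂ, ‖c‖ = 1 ∧ ∀ v > T, H v = c * ‖H v‖ := by
  obtain ⟨c, r, hc, hr, hHr⟩ : ∃ (c : ℂ) (r : ℝ → ℝ), ‖c‖ = 1 ∧ Continuous r ∧
      ∀ v, H v = c * r v := by
    rcases hε with rfl | rfl
    · refine ⟨1, fun v => (H v).re, by simp, by fun_prop, fun v => ?_⟩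
      rw [one_mul, eq_comm, ← conj_eq_iff_re, hconj, one_mul]
    · refine ⟨I, fun v => (H v).im, by simp, by fun_prop, fun v => ?_⟩
      have h := congrArg Complex.re (hconj v)
      rw [conj_re, neg_one_mul, neg_re] at h
      apply Complex.ext
      · simp; linarith
      · simp
  have hr0 : ∀ v > T, r v ≠ 0 := fun v hv h => hne v hv (by rw [hHr, h]; simp)
  have hsign : ∀ v > T, ∀ w > T, 0 < r v → 0 < r w := by
    intro v hv w hw h
    by_contra hneg
    obtain ⟨x, hx, hx0⟩ := isPreconnected_Ioi.intermediate_value hw hv hr.continuousOn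
      (⟨not_lt.mp hneg, h.le⟩ : (0 : ℝ) ∈ Icc (r w) (r v))
    exact hr0 x hx hx0
  have hnorm : ∀ v, ‖H v‖ = |r v| := fun v => by rw [hHr, norm_mul, hc, one_mul, norm_real]; rfl
  by_cases hpos : 0 < r (T + 1)
  · refine ⟨c, hc, fun v hv => ?_⟩
    rw [hnorm, abs_of_pos (hsign _ (by simp) _ hv hpos), ← hHr]
  · refine ⟨-c, by rwa [norm_neg], fun v hv => ?_⟩
    have : r v ≤ 0 := not_lt.mp fun h => hpos (hsign _ hv _ (by simp) h)
    rw [hnorm, abs_of_nonpos this, ofReal_neg, neg_mul_neg, ← hHr]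

/-- The Fourier transform of a function with `conj (g u) = ε g (-u)`. -/
lemma conj_fourier {g : ℝ → ℂ} {ε : ℂ} (hg : ∀ u, conj (g u) = ε * g (-u)) (v : ℝ) :
    conj (𝓕 g v) = ε * 𝓕 g v := by
  rw [Real.fourier_real_eq_integral_exp_smul, ← integral_conj, ← integral_const_mul,
    ← integral_neg_eq_self]
  refine integral_congr_ae (.of_forall fun u => ?_)
  simp only [smul_eq_mul, map_mul, ← Complex.exp_conj, hg, neg_neg, conj_ofReal, conj_I]
  rw [mul_left_comm]
  congr 3
  push_cast
  ring

/-! ### The Mellin transform along the vertical line -/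

section Level

variable {N : ℕ} {k : ℕ} (f : CuspFormGamma0 N k)

/-- The restriction of `f` to the vertical line through `x`, with the parametrization
`z = x + i t / q`. -/
noncomputable def CuspFormGamma0.vertical (x q t : ℝ) : ℂ := f (ofComplex (x + I * t / q))

/-- The substitution `t = exp(-u)` turns the line `re s = m = k/2` into the frequency axis. -/
lemma CuspFormGamma0.mellin_vertical_eq_fourier (m : ℕ) (x q v : ℝ) :
    mellin (vertical f x q) (m + 2 * Real.pi * v * I) =
      𝓕 (fun u : ℝ => logVertical f m x q u) v := by
  rw [mellin_eq_fourier]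
  have h1 : (m + 2 * Real.pi * v * I : ℂ).re = m := by simp
  have h2 : (m + 2 * Real.pi * v * I : ℂ).im = 2 * Real.pi * v := by simp
  rw [h1, h2, mul_div_cancel_left₀ _ (by positivity)]
  refine congrArg (fun g : ℝ → ℂ => 𝓕 g v) (funext fun u => ?_)
  rw [logVertical, vertical, real_smul]
  push_cast
  rfl

lemma CuspFormGamma0.continuousOn_vertical (x : ℝ) {q : ℝ} (hq : 0 < q) :
    ContinuousOn (vertical f x q) (Ioi 0) := by
  refine (CuspFormGamma0.differentiableOn f).continuousOn.comp
    (f := fun t : ℝ => (x + I * t / q : ℂ)) (by fun_prop) fun t (ht : 0 < t) => ?_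
  rw [mem_ofPred_eq, im_vertical, ofReal_re]
  positivity

lemma CuspFormGamma0.vertical_isBigO (hN : 0 < N) (x : ℝ) {q : ℝ} (hq : 0 < q) (r : ℝ) :
    vertical f x q =O[atTop] fun t : ℝ => t ^ r := by
  have : NeZero N := ⟨hN.ne'⟩
  obtain ⟨c, hc, hO⟩ := CuspFormClass.exp_decay_atImInfty' (k := k) f
  have him : ∀ t : ℝ, 0 < t → (ofComplex (x + I * t / q)).im = t / q := by
    intro t ht
    have h := im_vertical x q t
    rw [ofReal_re] at h
    rw [UpperHalfPlane.ofComplex_apply_of_im_pos (by rw [h]; positivity)]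
    exact h
  have htend : Tendsto (fun t : ℝ => ofComplex (x + I * t / q)) atTop atImInfty := by
    rw [UpperHalfPlane.atImInfty, tendsto_comap_iff]
    refine (tendsto_id.atTop_div_const hq).congr' ?_
    filter_upwards [eventually_gt_atTop 0] with t ht
    exact (him t ht).symm
  refine (hO.comp_tendsto htend).trans ?_
  refine (EventuallyEq.isBigO ?_).trans
    (isLittleO_exp_neg_mul_rpow_atTop (show 0 < c / q by positivity) r).isBigO
  filter_upwards [eventually_gt_atTop 0] with t ht
  rw [Function.comp_apply, him t ht]
  congr 1
  ring

/-- The Mellin transform along the vertical line is entire. -/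
lemma CuspFormGamma0.differentiable_mellin_vertical (hN : 0 < N) (hk0 : 0 < k) {x q : ℝ}
    (hq : 0 < q) {ε : ℂ} (hε : ε ≠ 0)
    (hfe : ∀ t > 0, vertical f x q (1 / t) = ε * (t : ℂ) ^ k * conj (vertical f x q t)) :
    Differentiable ℂ (mellin (vertical f x q)) := by
  have hbd := vertical_isBigO f hN x hq
  -- The dual function is the complex conjugate; both constant terms vanish by cuspidality, so the
  -- pair is strong and the Mellin transform has no poles.
  let P : WeakFEPair ℂ :=
    { f := vertical f x q
      g := fun t => conj (vertical f x q t)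
      k := k
      ε := ε
      f₀ := 0
      g₀ := 0
      hf_int := (continuousOn_vertical f x hq).locallyIntegrableOn measurableSet_Ioi
      hg_int := (continuous_conj.comp_continuousOn
        (continuousOn_vertical f x hq)).locallyIntegrableOn measurableSet_Ioi
      hk := by exact_mod_cast hk0
      hε := hε
      h_feq := fun t ht => by
        rw [hfe t ht, smul_eq_mul, Real.rpow_natCast, ofReal_pow]
      hf_top := fun r => by simpa using hbd r
      hg_top := fun r => by
        simp only [sub_zero]
        exact Asymptotics.IsBigO.of_norm_left (by simpa using (hbd r).norm_left) }
  have hP : IsStrongFEPair P := ⟨rfl, rfl⟩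
  have := hP.differentiable_Λ
  rwa [hP.Λ_eq] at this

end Level

/-! ### The twisted Dirichlet series and its continuation -/

lemma norm_additiveTwist (a : ℕ → ℂ) (x : ℝ) (n : ℕ) : ‖additiveTwist a x n‖ = ‖a n‖ := by
  rw [additiveTwist, norm_mul,
    show (2 * Real.pi * I * n * x : ℂ) = ((2 * Real.pi * n * x : ℝ) : ℂ) * I by push_cast; ring,
    norm_exp_ofReal_mul_I, mul_one]

/-- Hecke's bound for the additively twisted normalized coefficients. -/
lemma HasNormalizedFourierExpansion.additiveTwist_isBigO {N k : ℕ} (hN : 0 < N)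
    {f : CuspFormGamma0 N k} {a : ℕ → ℂ} (hf : HasNormalizedFourierExpansion k f a) (x : ℝ) :
    additiveTwist a x =O[atTop] fun n : ℕ => (n : ℝ) ^ (1 / 2 : ℝ) := by
  have : NeZero N := ⟨hN.ne'⟩
  have h := CuspFormClass.qExpansion_isBigO (k := k) f
  rw [CongruenceSubgroup.strictWidthInfty_Gamma0] at h
  obtain ⟨C, hC⟩ := h.bound
  refine Asymptotics.IsBigO.of_bound C ?_
  filter_upwards [hC, eventually_gt_atTop 0] with n hn hn0
  have hnpos : (0 : ℝ) < n := by exact_mod_cast hn0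
  rw [hf.coeff_eq f hn0, norm_mul, norm_real, Real.norm_of_nonneg (by positivity),
    Real.norm_of_nonneg (by positivity)] at hn
  rw [norm_additiveTwist, Real.norm_of_nonneg (by positivity)]
  push_cast at hn
  rw [show (k : ℝ) / 2 = 1 / 2 + (k - 1) / 2 by ring, Real.rpow_add hnpos, ← mul_assoc] at hn
  exact le_of_mul_le_mul_right hn (by positivity)

/-- The Dirichlet series as a Mellin transform along a vertical line. -/
lemma HasNormalizedFourierExpansion.hasSum_mellin_vertical {N k : ℕ}
    {f : CuspFormGamma0 N k} {a : ℕ → ℂ} (hf : HasNormalizedFourierExpansion k f a) (hk0 : 0 < k)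
    (x : ℝ) {q : ℝ} (hq : 0 < q) {s : ℂ} (hs0 : 0 < s.re)
    (hs : LSeriesSummable (additiveTwist a x) s) :
    LSeriesHasSum (additiveTwist a x) s
      (((2 * Real.pi / q : ℝ) : ℂ) ^ (s + (k - 1) / 2) * (Gamma (s + (k - 1) / 2))⁻¹ *
        mellin (CuspFormGamma0.vertical f x q) (s + (k - 1) / 2)) := by
  set w : ℂ := s + (k - 1) / 2 with hw
  have hk1 : (1 : ℝ) ≤ k := by exact_mod_cast hk0
  have hwre : w.re = s.re + (k - 1) / 2 := by
    rw [hw, show ((k : ℂ) - 1) / 2 = (((k - 1) / 2 : ℝ) : ℂ) by push_cast; rfl, add_re, ofReal_re]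
  have hw0 : 0 < w.re := by rw [hwre]; linarith
  have hΓ : Gamma w ≠ 0 := Gamma_ne_zero_of_re_pos hw0
  have hc0 : (0 : ℝ) < 2 * Real.pi / q := by positivity
  have hcw : ((2 * Real.pi / q : ℝ) : ℂ) ^ w ≠ 0 := by
    rw [cpow_ne_zero_iff]
    exact Or.inl (by exact_mod_cast hc0.ne')
  -- The shift of `s` by `(k - 1)/2` absorbs the normalization of the coefficients.
  have hterm : ∀ n : ℕ+, LSeries.term (additiveTwist a x) s n =
      (a n * (((n : ℝ) ^ (((k : ℝ) - 1) / 2) : ℝ) : ℂ) *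
        cexp (2 * Real.pi * I * n * x)) / ((n : ℝ) : ℂ) ^ w := by
    intro n
    have hn : ((n : ℕ) : ℂ) ≠ 0 := by exact_mod_cast n.ne_zero
    have hn' : (0 : ℝ) < n := by exact_mod_cast n.pos
    rw [LSeries.term_of_ne_zero n.ne_zero, hw, ofReal_natCast, cpow_add _ _ hn, additiveTwist,
      ofReal_cpow hn'.le]
    push_cast
    have : ((n : ℕ) : ℂ) ^ (((k : ℂ) - 1) / 2) ≠ 0 := by
      rw [cpow_ne_zero_iff]; exact Or.inl hn
    field_simp
  have hpow : ∀ n : ℕ+, ((2 * Real.pi / q * n : ℝ) : ℂ) ^ w =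
      ((2 * Real.pi / q : ℝ) : ℂ) ^ w * ((n : ℝ) : ℂ) ^ w := fun n => by
    rw [ofReal_mul, mul_cpow_ofReal_nonneg hc0.le (by positivity)]
  have key := hasSum_mellin (ι := ℕ+) (s := w) (F := CuspFormGamma0.vertical f x q)
    (a := fun n => a n * (((n : ℝ) ^ (((k : ℝ) - 1) / 2) : ℝ) : ℂ) *
      cexp (2 * Real.pi * I * n * x))
    (p := fun n => 2 * Real.pi / q * n) (fun n => Or.inr (by positivity)) hw0
    (fun t (ht : 0 < t) => by
      have him : 0 < (x + I * t / q : ℂ).im := by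
        rw [im_vertical, ofReal_re]; positivity
      have h := hf ⟨_, him⟩
      rw [CuspFormGamma0.vertical, UpperHalfPlane.ofComplex_apply_of_im_pos him]
      convert h using 2 with n
      rw [mul_assoc _ (cexp _), ofReal_exp, ← Complex.exp_add]
      congr 2
      push_cast
      field_simp
      linear_combination (-(t : ℂ) / q) * I_sq)
    (by
      have h1 : Summable fun n : ℕ+ => ‖LSeries.term (additiveTwist a x) s n‖ :=
        hs.norm.comp_injective PNat.coe_injective
      refine (h1.mul_left (1 / (2 * Real.pi / q) ^ w.re)).congr fun n => ?_
      have hn' : (0 : ℝ) < n := by exact_mod_cast n.pos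
      rw [hterm, norm_div, norm_cpow_eq_rpow_re_of_pos hn', Real.mul_rpow hc0.le hn'.le]
      field_simp)
  have key2 := key.mul_left (((2 * Real.pi / q : ℝ) : ℂ) ^ w * (Gamma w)⁻¹)
  rw [LSeriesHasSum, ← PNat.coe_injective.hasSum_iff]
  · refine key2.congr_fun fun n => ?_
    rw [Function.comp_apply, hterm, hpow]
    have : ((n : ℝ) : ℂ) ^ w ≠ 0 := by
      rw [cpow_ne_zero_iff]; exact Or.inl (by exact_mod_cast n.ne_zero)
    field_simp
  · intro n hn
    have : n = 0 := by
      by_contra h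
      exact hn ⟨⟨n, Nat.pos_of_ne_zero h⟩, rfl⟩
    rw [this, LSeries.term_zero]

/-- The entire continuation of an additively twisted `L`-series. -/
lemma HasNormalizedFourierExpansion.isEntireContinuation {N k : ℕ} (hN : 0 < N)
    {f : CuspFormGamma0 N k} {a : ℕ → ℂ} (hf : HasNormalizedFourierExpansion k f a) (hk0 : 0 < k)
    {x q : ℝ} (hq : 0 < q) (hd : Differentiable ℂ (mellin (CuspFormGamma0.vertical f x q))) :
    IsEntireContinuation (additiveTwist a x) fun s =>
      ((2 * Real.pi / q : ℝ) : ℂ) ^ (s + (k - 1) / 2) * (Gamma (s + (k - 1) / 2))⁻¹ *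
        mellin (CuspFormGamma0.vertical f x q) (s + (k - 1) / 2) := by
  have hO := hf.additiveTwist_isBigO hN x
  have habs := LSeries.abscissaOfAbsConv_le_of_isBigO_rpow hO
  have hc0 : (0 : ℝ) < 2 * Real.pi / q := by positivity
  set L : ℂ → ℂ := fun s =>
      ((2 * Real.pi / q : ℝ) : ℂ) ^ (s + (k - 1) / 2) * (Gamma (s + (k - 1) / 2))⁻¹ *
        mellin (CuspFormGamma0.vertical f x q) (s + (k - 1) / 2) with hL
  have hLd : Differentiable ℂ L := by
    have h1 : Differentiable ℂ fun s : ℂ => (Gamma (s + (k - 1) / 2))⁻¹ :=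
      differentiable_one_div_Gamma.comp (by fun_prop : Differentiable ℂ fun s : ℂ => s + (k - 1) / 2)
    have h2 : Differentiable ℂ fun s : ℂ =>
        mellin (CuspFormGamma0.vertical f x q) (s + (k - 1) / 2) := hd.comp (by fun_prop)
    have h3 : Differentiable ℂ fun s : ℂ => ((2 * Real.pi / q : ℝ) : ℂ) ^ (s + (k - 1) / 2) := by
      intro s
      refine DifferentiableAt.const_cpow (by fun_prop) (Or.inl (by exact_mod_cast hc0.ne'))
    exact (h3.mul h1).mul h2
  have hfar : ∀ s : ℂ, 3 / 2 < s.re → L s = LSeries (additiveTwist a x) s := by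
    intro s hs
    have h := hf.hasSum_mellin_vertical hk0 x hq (s := s) (by linarith)
      (LSeriesSummable_of_isBigO_rpow (x := 3 / 2) hs (by convert hO using 3; norm_num))
    exact h.LSeries_eq.symm
  refine ⟨habs.trans_lt (by exact EReal.coe_lt_top _), hLd, fun s hs => ?_⟩
  -- Hecke's bound yields the identity only for `re s > 3/2`, whereas the abscissa may be smaller;
  -- the identity theorem covers the rest of the half-plane of absolute convergence.
  have hconv : IsPreconnected {s : ℂ | LSeries.abscissaOfAbsConv (additiveTwist a x) < s.re} := by
    have hord : OrdConnected {y : ℝ | LSeries.abscissaOfAbsConv (additiveTwist a x) < y} :=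
      ⟨fun y hy z _ t ht => lt_of_lt_of_le hy (EReal.coe_le_coe_iff.mpr ht.1)⟩
    exact (hord.convex.linear_preimage reLm).isPreconnected
  refine (hLd.differentiableOn.analyticOnNhd isOpen_univ |>.mono (subset_univ _)
    |>.eqOn_of_preconnected_of_eventuallyEq (LSeries_analyticOnNhd _) hconv (z₀ := 2) ?_ ?_) hs
  · refine lt_of_le_of_lt habs ?_
    exact_mod_cast (by norm_num : (1 / 2 + 1 : ℝ) < 2)
  · filter_upwards [(isOpen_lt continuous_const continuous_re).mem_nhds
      (show (3 / 2 : ℝ) < (2 : ℂ).re by norm_num)] with z hz using hfar z hz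

lemma I_pow_two_mul (m : ℕ) : (I : ℂ) ^ (2 * m) = 1 ∨ (I : ℂ) ^ (2 * m) = -1 := by
  rw [pow_mul, I_sq]
  exact neg_one_pow_eq_or ℂ m

/-! ### Zeros on the critical line -/

section Level

variable {N : ℕ} {k : ℕ} (f : CuspFormGamma0 N k)

/-- The Mellin transform on the critical line vanishes at arbitrarily large heights. -/
lemma CuspFormGamma0.exists_mellin_vertical_eq_zero (hN : 0 < N) {m : ℕ} (hm : 0 < m)
    (hk : k = 2 * m) {p : ℤ} {q : ℕ} (hq : 0 < q) (hne : ∃ τ, f τ ≠ 0)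
    (hfe : ∀ t > 0, vertical f (p / q) q (1 / t) =
      I ^ k * (t : ℂ) ^ k * conj (vertical f (p / q) q t)) (T : ℝ) :
    ∃ v > T, mellin (vertical f (p / q) q) (m + 2 * Real.pi * v * I) = 0 := by
  by_contra! hno
  obtain ⟨τ, hτ⟩ := hne
  have hqR : (0 : ℝ) < q := by exact_mod_cast hq
  set G := logVertical f m (p / q) q with hG
  have hd := differentiableOn_logVertical f m (p / q) hqR
  have hdec : ∀ b < Real.pi / 2, ∃ C, ∀ z : ℂ, |z.im| ≤ b → ‖G z‖ ≤ C * Real.exp (-|z.re|) :=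
    fun b hb => logVertical_decay f hN hm hk p hq hb
  have hε := I_pow_two_mul m
  rw [← hk] at hε
  -- The functional equation `t ↦ 1/t` becomes `u ↦ -u`; the factor `exp(-mu)` balances the weight
  -- because `k = 2m`.
  have hsymm : ∀ u : ℝ, conj (G u) = I ^ k * G ((-u : ℝ)) := by
    intro u
    have hGu : ∀ u : ℝ, G u = (Real.exp (-(m * u)) : ℂ) * vertical f (p / q) q (Real.exp (-u)) := by
      intro u
      rw [hG, logVertical, vertical]
      push_cast
      rw [neg_mul]
    have h1 := hfe (Real.exp (-u)) (Real.exp_pos _)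
    rw [one_div, ← Real.exp_neg, neg_neg] at h1
    have h2 : (I : ℂ) ^ k * I ^ k = 1 := by rcases hε with h | h <;> rw [h] <;> norm_num
    rw [hGu, hGu, neg_neg, h1, map_mul, conj_ofReal, ← ofReal_pow, ← Real.exp_nat_mul]
    have h3 : Real.exp (-(m * u)) = Real.exp (-(m * -u)) * Real.exp (k * -u) := by
      rw [← Real.exp_add, hk]; congr 1; push_cast; ring
    rw [h3, ofReal_mul]
    linear_combination -(Real.exp (-(m * -u)) : ℂ) * Real.exp (k * -u) *
      conj (vertical f (p / q) q (Real.exp (-u))) * h2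
  have hint : Integrable (fun u : ℝ => G u) := by
    simpa using integrable_horizontal hd hdec (φ := 0) (by simpa using Real.pi_pos)
  have hcont : Continuous (𝓕 (fun u : ℝ => G u)) :=
    VectorFourier.fourierIntegral_continuous Real.continuous_fourierChar
      (by exact continuous_inner) hint
  obtain ⟨c, hc1, hc⟩ := exists_phase hcont hε (T := T) (fun v => conj_fourier hsymm v)
    (fun v hv => by
      rw [← mellin_vertical_eq_fourier]
      exact hno v hv)
  obtain ⟨B, hB⟩ := logVertical_bounded f hN m p hq
  obtain ⟨B', hB'⟩ := bounded_of_fourier_phase (by positivity) hd hdec hc1 hc hB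
  exact hτ (eq_zero_of_logVertical_bounded f hN (by omega) m p hq hB' τ)

end Level

theorem theorem1 (k : ℕ) (hk : Even k) (hk0 : 0 < k) (N : ℕ) (hN : 0 < N)
    (p : ℤ) (q : ℕ) (hq : 0 < q)
    (hpq : IsGamma0EquivInfty N ((p : ℝ) / (q : ℝ)))
    (hp : p ^ 2 ≡ 1 [ZMOD (q : ℤ)])
    (f : CuspFormGamma0 N k) (a : ℕ → ℝ)
    (hf : HasNormalizedFourierExpansion k f (fun n => (a n : ℂ)))
    (ha1 : a 1 ≠ 0) :
    ∃ L : ℂ → ℂ,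
      IsEntireContinuation (additiveTwist (fun n => (a n : ℂ)) ((p : ℝ) / (q : ℝ))) L ∧
      {s : ℂ | s.re = 1 / 2 ∧ L s = 0}.Infinite := by
  have hqR : (0 : ℝ) < q := by exact_mod_cast hq
  obtain ⟨m, hm⟩ := hk.exists_two_nsmul
  rw [smul_eq_mul] at hm
  have hfe : ∀ t > 0, CuspFormGamma0.vertical f (p / q) q (1 / t) =
      I ^ k * (t : ℂ) ^ k * conj (CuspFormGamma0.vertical f (p / q) q t) := fun t ht => by
    have h := CuspFormGamma0.functional_equation f hk hq hpq hp hf ht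
    rw [← mul_pow]
    simpa only [CuspFormGamma0.vertical, ofReal_div, ofReal_intCast, ofReal_natCast] using h
  have hne : ∃ τ, f τ ≠ 0 := by
    by_contra! h0
    have h1 := hf.coeff_eq f one_pos
    rw [show (f : ℍ → ℂ) = 0 from funext h0, UpperHalfPlane.qExpansion_zero] at h1
    simp only [map_zero, Nat.cast_one, Real.one_rpow, ofReal_one, mul_one] at h1
    exact ha1 (by exact_mod_cast h1.symm)
  refine ⟨_, hf.isEntireContinuation hN hk0 hqR
    (CuspFormGamma0.differentiable_mellin_vertical f hN hk0 hqR (pow_ne_zero k I_ne_zero) hfe),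
    fun hfin => ?_⟩
  -- Finitely many zeros would have bounded heights, but the Mellin transform vanishes at heights
  -- `2πv` with `v` arbitrarily large.
  obtain ⟨M, hM⟩ := (hfin.image Complex.im).bddAbove
  obtain ⟨v, hv, hv0⟩ := CuspFormGamma0.exists_mellin_vertical_eq_zero f hN (by omega) hm hq hne
    hfe (M / (2 * Real.pi))
  rw [gt_iff_lt, div_lt_iff₀ (by positivity)] at hv
  have e : (1 / 2 + 2 * Real.pi * v * I + (k - 1) / 2 : ℂ) = m + 2 * Real.pi * v * I := by
    rw [hm]; push_cast; ring
  have h := hM ⟨(1 / 2 + 2 * Real.pi * v * I : ℂ), ⟨by simp, by rw [e, hv0, mul_zero]⟩, rfl⟩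
  have him : (1 / 2 + 2 * Real.pi * v * I : ℂ).im = v * (2 * Real.pi) := by simp; ring
  rw [him] at h
  linarith
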